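/- Let $U\subset\mathbb{C}$ be an open neighbourhood of $0$, and let $f,g:U\to\mathbb{C}$ be holomorphic functions with $$f(z)=z+\alpha z^{p+1}+O(z^{p+2}),\qquad g(z)=z+\beta z^{q+1}+O(z^{q+2})\qquad (z\to 0),$$ where $\alpha,\beta\in\mathbb{C}$ are non-zero and $p,q$ are integers with $1\le p<q$. Let $J\subset U$ be a set that is closed in $U$ and completely invariant under $f$ and under $g$ near $0$; here $J$ is called completely invariant under $h:U\to\mathbb{C}$ near $0$ if there is a neighbourhood $V\subset U$ of $0$ such that $h(J)\cap V=J\cap V$ and $h^{-1}(J)\cap V=J\cap V$. Then there is an open neighbourhood $V\subset U$ of $0$ such that $J$ is analytically laminated in $V\setminus\{0\}$, that is: every $z\in V\setminus\{0\}$ has an open neighbourhood $W\subset\mathbb{C}$ for which there are a set $K\subset\mathbb{R}$ and a real analytic function $\sigma:W\to\mathbb{R}$, of maximal rank (equal to $1$) at every point of $W$, with $J\cap W=\sigma^{-1}(K)$. -/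

import Mathlib

open Set Topology Asymptotics

/-- `J` is completely invariant under `f` near `0`, where `f` is a map defined on the
neighbourhood `U` of `0` and `J ⊆ U`: there is a neighbourhood `V ⊆ U` of `0` such that
`f (J) ∩ V = J ∩ V` and `f⁻¹ (J) ∩ V = J ∩ V`.  Here `f⁻¹ (J)` is the full preimage of `J`
under the map `f : U → ℂ`. -/
def CompletelyInvariantNearZero (U : Set ℂ) (f : ℂ → ℂ) (J : Set ℂ) : Prop :=
  ∃ V ∈ 𝓝 (0 : ℂ), V ⊆ U ∧ f '' J ∩ V = J ∩ V ∧ (U ∩ f ⁻¹' J) ∩ V = J ∩ V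

/-- `J` is analytically laminated at `z`: on an open neighbourhood `V` of `z`, the set `J` is
the preimage of a set `K` of real numbers under a real analytic function `σ : V → ℝ` whose
rank is maximal (equal to `1`) at every point of `V`. -/
def AnalyticallyLaminatedAt (J : Set ℂ) (z : ℂ) : Prop :=
  ∃ (V : Set ℂ) (K : Set ℝ) (σ : ℂ → ℝ), IsOpen V ∧ z ∈ V ∧ AnalyticOnNhd ℝ σ V ∧
    (∀ w ∈ V, Function.Surjective (fderiv ℝ σ w)) ∧ J ∩ V = V ∩ σ ⁻¹' K

/-- `J` is analytically laminated in the open set `W`: it is so at every point of `W`. -/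
def AnalyticallyLaminatedIn (J W : Set ℂ) : Prop :=
  ∀ z ∈ W, AnalyticallyLaminatedAt J z

/-! ### Germs tangent to the identity: inverse, derivative, multiplier. -/

section Germs

open Filter

/-! Fix `z₀` in an attracting petal of `f` and let `s_k = f^[k] z₀`, which tends to `0` like `k ^
(-1/p)`. The renormalized iterates `(f^[k] z - s_k) / s_k ^ (p + 1)` converge near `z₀` to a
holomorphic `Ψ` with nonvanishing derivative, essentially a Fatou coordinate
(`exists_renormalized_limit`). The convergence rests on `isBigO_multiplier`: up to a telescoping
factor, the derivative of `f^[k]` is a product whose factors differ from `1` by a summable amount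
along the orbit.

At the point `s_k`, one step of `g` is a displacement of about `β s_k ^ (q + 1)`, which is `β s_k ^
(q - p)` in the renormalized coordinate. This is infinitesimal because `p < q`, so about `t / |s_k|
^ (q - p)` steps amount in the limit to the translation by `t c`, where `c = β ν ^ (q - p)` and `ν`
is a limit of the directions `s_k / |s_k|` (`exists_iterate_bound`, `mem_of_flow`). Pulling back by
`f^[k]` and using that `J` is closed, `J` is invariant under all translations `Ψ ↦ Ψ + t c` with `t
≥ 0`, and the inverse of `g` gives `t ≤ 0`. Hence near `z₀` the set `J` is a union of level sets of
`Im (Ψ / c)`.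

The petals of `f` and of its local inverse cover a punctured neighbourhood of `0`. -/

/-- The holomorphic germ `f z = z + a z ^ (n + 1) + O(z ^ (n + 2))` at `0`. -/
structure IsTangentToId (f : ℂ → ℂ) (n : ℕ) (a : ℂ) : Prop where
  analyticAt : AnalyticAt ℂ f 0
  isBigO : (fun z : ℂ => f z - (z + a * z ^ (n + 1))) =O[𝓝 0] (fun z : ℂ => z ^ (n + 2))

/-- Invariance of a set under a germ and its inverse. -/
def InvariantNearZero (J : Set ℂ) (f : ℂ → ℂ) : Prop :=
  ∀ᶠ z in 𝓝 (0 : ℂ), f z ∈ J ↔ z ∈ J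

theorem isBigO_pow_pow_zero {m n : ℕ} (h : n ≤ m) :
    (fun z : ℂ => z ^ m) =O[𝓝 0] (fun z : ℂ => z ^ n) := by
  obtain ⟨k, rfl⟩ := Nat.exists_eq_add_of_le h
  have h1 : (fun z : ℂ => z ^ k) =O[𝓝 0] (fun _ : ℂ => (1 : ℂ)) :=
    (continuous_pow k).continuousAt.isBigO_one ℂ
  simpa [pow_add] using (isBigO_refl (fun z : ℂ => z ^ n) (𝓝 0)).mul h1

namespace IsTangentToId

variable {f : ℂ → ℂ} {n : ℕ} {a : ℂ}

theorem map_zero (h : IsTangentToId f n a) : f 0 = 0 := by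
  obtain ⟨C, hC⟩ := h.isBigO.bound
  have := hC.self_of_nhds
  simpa using this

theorem isBigO_sub_id (h : IsTangentToId f n a) :
    (fun z : ℂ => f z - z) =O[𝓝 0] (fun z : ℂ => z ^ (n + 1)) := by
  have h1 := h.isBigO.trans (isBigO_pow_pow_zero (show n + 1 ≤ n + 2 by omega))
  have h2 : (fun z : ℂ => a * z ^ (n + 1)) =O[𝓝 0] (fun z : ℂ => z ^ (n + 1)) :=
    (isBigO_refl _ _).const_mul_left a
  exact (h1.add h2).congr_left fun z => by ring

theorem tendsto (h : IsTangentToId f n a) : Tendsto f (𝓝 0) (𝓝 0) := by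
  simpa [ContinuousAt, h.map_zero] using h.analyticAt.continuousAt

/-- Cauchy's estimate for the remainder on the circle of radius `‖z‖` about `z`, where points have
norm at most `2 * ‖z‖`. -/
theorem isBigO_deriv (h : IsTangentToId f n a) :
    (fun z : ℂ => deriv f z - (1 + (n + 1) * a * z ^ n)) =O[𝓝 0] (fun z : ℂ => z ^ (n + 1)) := by
  obtain ⟨C, hC⟩ := h.isBigO.bound
  obtain ⟨r, hr, hball⟩ := Metric.eventually_nhds_iff_ball.1
    (hC.and h.analyticAt.eventually_analyticAt)
  set F : ℂ → ℂ := fun z => f z - (z + a * z ^ (n + 1)) with hF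
  have hdF : ∀ z ∈ Metric.ball (0 : ℂ) r,
      HasDerivAt F (deriv f z - (1 + (n + 1) * a * z ^ n)) z := by
    intro z hz
    have := (hball z hz).2.differentiableAt.hasDerivAt.sub
      ((hasDerivAt_id z).add ((hasDerivAt_pow (n + 1) z).const_mul a))
    refine this.congr_deriv ?_
    push_cast
    simp
    ring
  refine IsBigO.of_bound (C * 2 ^ (n + 2)) ?_
  filter_upwards [Metric.ball_mem_nhds (0 : ℂ) (half_pos hr)] with z hz
  have hz' : ‖z‖ < r / 2 := by simpa using hz
  rw [← (hdF z (Metric.ball_subset_ball (by linarith) hz)).deriv]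
  have hF0 : F 0 = 0 := by simp [hF, h.map_zero]
  rcases eq_or_ne z 0 with rfl | hz0
  -- The circle of radius `‖z‖` degenerates at `z = 0`; circles of radius `ρ → 0` replace it.
  · have hle : ∀ ρ, 0 < ρ → ρ < r → ‖deriv F 0‖ ≤ C * ρ ^ (n + 2) / ρ := by
      intro ρ hρ hρr
      refine Complex.norm_deriv_le_of_forall_mem_sphere_norm_le hρ ?_ ?_
      · refine DifferentiableOn.diffContOnCl_ball (U := Metric.ball 0 r) ?_ ?_
        · exact fun w hw => (hdF w hw).differentiableAt.differentiableWithinAt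
        · exact Metric.closedBall_subset_ball hρr
      · intro w hw
        have hw' : ‖w‖ = ρ := by simpa using hw
        have := (hball w (by simpa [hw'] using hρr)).1
        simpa [hw'] using this
    have hlim : Tendsto (fun ρ : ℝ => C * ρ ^ (n + 2) / ρ) (𝓝[>] 0) (𝓝 0) := by
      have : Tendsto (fun ρ : ℝ => C * ρ ^ (n + 1)) (𝓝[>] 0) (𝓝 0) := by
        have := ((continuous_const (y := C)).mul (continuous_pow (n + 1))).tendsto (0 : ℝ)
        simp at this
        exact this.mono_left nhdsWithin_le_nhds
      refine this.congr' ?_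
      filter_upwards [self_mem_nhdsWithin] with ρ hρ
      have : ρ ≠ 0 := ne_of_gt hρ
      field_simp
      ring
    have : ‖deriv F 0‖ ≤ 0 := by
      refine ge_of_tendsto hlim ?_
      filter_upwards [Ioo_mem_nhdsGT hr] with ρ hρ using hle ρ hρ.1 hρ.2
    simpa using this
  · have hzp : 0 < ‖z‖ := norm_pos_iff.2 hz0
    have key : ‖deriv F z‖ ≤ C * (2 * ‖z‖) ^ (n + 2) / ‖z‖ := by
      have hsub : Metric.closedBall z ‖z‖ ⊆ Metric.ball 0 r := by
        intro w hw
        have : ‖w - z‖ ≤ ‖z‖ := by simpa [dist_eq_norm] using hw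
        have h2 : ‖w‖ ≤ ‖w - z‖ + ‖z‖ := by simpa using norm_add_le (w - z) z
        simp
        linarith
      have hC0 : 0 ≤ C := by
        have := (norm_nonneg _).trans (hball z (Metric.ball_subset_ball (by linarith) hz)).1
        exact nonneg_of_mul_nonneg_left this (norm_pos_iff.2 (pow_ne_zero _ hz0))
      refine Complex.norm_deriv_le_of_forall_mem_sphere_norm_le hzp ?_ ?_
      · refine DifferentiableOn.diffContOnCl_ball (U := Metric.ball 0 r) ?_ hsub
        exact fun w hw => (hdF w hw).differentiableAt.differentiableWithinAt
      · intro w hw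
        have h1 : ‖w - z‖ = ‖z‖ := by simpa [dist_eq_norm] using hw
        have h2 : ‖w‖ ≤ ‖w - z‖ + ‖z‖ := by simpa using norm_add_le (w - z) z
        refine (hball w (hsub (Metric.sphere_subset_closedBall hw))).1.trans ?_
        rw [norm_pow]
        gcongr
        linarith
    refine key.trans (le_of_eq ?_)
    rw [norm_pow]
    field_simp
    ring

theorem deriv_zero (h : IsTangentToId f n a) (hn : 1 ≤ n) : deriv f 0 = 1 := by
  obtain ⟨C, hC⟩ := h.isBigO_deriv.bound
  have := hC.self_of_nhds
  have h0 : n ≠ 0 := by omega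
  simpa [h0, sub_eq_zero] using this

theorem eventually_deriv_ne_zero (h : IsTangentToId f n a) (hn : 1 ≤ n) :
    ∀ᶠ z in 𝓝 (0 : ℂ), deriv f z ≠ 0 :=
  h.analyticAt.deriv.continuousAt.eventually_ne (by simp [h.deriv_zero hn])

/-- The local inverse of a germ tangent to the identity. -/
theorem exists_inverse (h : IsTangentToId f n a) (hn : 1 ≤ n) :
    ∃ k : ℂ → ℂ, IsTangentToId k n (-a) ∧ ∀ᶠ z in 𝓝 (0 : ℂ), f (k z) = z := by
  have hd' : deriv f 0 ≠ 0 := by simp [h.deriv_zero hn]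
  set k := h.analyticAt.hasStrictDerivAt.localInverse _ _ _ hd' with hk
  have hka : AnalyticAt ℂ k 0 := by
    have := h.analyticAt.analyticAt_localInverse hd'
    rwa [h.map_zero] at this
  have hinv : ∀ᶠ z in 𝓝 (0 : ℂ), f (k z) = z := by
    have : ∀ᶠ z in 𝓝 (f 0), f (k z) = z := HasStrictDerivAt.eventually_right_inverse ..
    rwa [h.map_zero] at this
  have hk0 : k 0 = 0 := by
    have : k (f 0) = 0 :=
      HasStrictFDerivAt.localInverse_apply_image (h.analyticAt.hasStrictDerivAt.hasStrictFDerivAt_equiv hd')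
    rwa [h.map_zero] at this
  have hkt : Tendsto k (𝓝 0) (𝓝 0) := by
    simpa [ContinuousAt, hk0] using hka.continuousAt
  have hkO : k =O[𝓝 0] (fun z : ℂ => z) := by
    simpa [hk0] using hka.differentiableAt.isBigO_sub
  refine ⟨k, ⟨hka, ?_⟩, hinv⟩
  -- The expansion of `f` evaluated at `k z`. It remains to replace `k z ^ (n + 1)` by `z ^ (n +
  -- 1)`, which is `e3`.
  have e1 : (fun z : ℂ => z - (k z + a * k z ^ (n + 1))) =O[𝓝 0] (fun z : ℂ => z ^ (n + 2)) := by
    refine ((h.isBigO.comp_tendsto hkt).trans (hkO.pow (n + 2))).congr' ?_ EventuallyEq.rfl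
    filter_upwards [hinv] with z hz
    simp [hz]
  have e2 : (fun z : ℂ => z - k z) =O[𝓝 0] (fun z : ℂ => z ^ 2) := by
    refine (((h.isBigO_sub_id.comp_tendsto hkt).trans (hkO.pow (n + 1))).trans
      (isBigO_pow_pow_zero (show 2 ≤ n + 1 by omega))).congr' ?_ EventuallyEq.rfl
    filter_upwards [hinv] with z hz
    simp [hz]
  have e3 : (fun z : ℂ => z ^ (n + 1) - k z ^ (n + 1)) =O[𝓝 0] (fun z : ℂ => z ^ (n + 2)) := by
    have hs : (fun z : ℂ => ∑ i ∈ Finset.range (n + 1), z ^ i * k z ^ (n + 1 - 1 - i))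
        =O[𝓝 0] (fun z : ℂ => z ^ n) := by
      refine IsBigO.fun_sum fun i hi => ?_
      have hi' : i + (n + 1 - 1 - i) = n := by
        have := Finset.mem_range.1 hi
        omega
      have := (isBigO_refl (fun z : ℂ => z ^ i) (𝓝 0)).mul (hkO.pow (n + 1 - 1 - i))
      refine this.congr_right fun z => ?_
      rw [← pow_add, hi']
    refine (e2.mul hs).congr (fun z => ?_) fun z => by ring
    rw [mul_comm, (Commute.all z (k z)).geom_sum₂_mul]
  refine ((e3.const_mul_left a).sub e1).congr_left fun z => ?_
  ring

theorem invariantNearZero_of_inverse {J : Set ℂ} {k : ℂ → ℂ} (hk : Tendsto k (𝓝 0) (𝓝 0))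
    (hJ : InvariantNearZero J f) (hinv : ∀ᶠ z in 𝓝 (0 : ℂ), f (k z) = z) :
    InvariantNearZero J k := by
  filter_upwards [hinv, hk.eventually hJ] with z h1 h2
  rw [← h2, h1]

theorem tendsto_div_self (h : IsTangentToId f n a) (hn : 1 ≤ n) :
    Tendsto (fun z : ℂ => f z / z) (𝓝[≠] 0) (𝓝 1) := by
  have h1 : (fun z : ℂ => f z - z) =o[𝓝 0] (fun z : ℂ => z) := by
    refine h.isBigO_sub_id.trans_isLittleO ?_
    simpa using isLittleO_pow_pow (𝕜 := ℂ) (show 1 < n + 1 by omega)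
  have h2 := (h1.tendsto_div_nhds_zero.mono_left
    (nhdsWithin_le_nhds (s := {(0 : ℂ)}ᶜ))).const_add 1
  rw [add_zero] at h2
  refine h2.congr' ?_
  filter_upwards [self_mem_nhdsWithin] with z hz
  have : z ≠ 0 := hz
  field_simp
  ring

theorem isBigO_div_self (h : IsTangentToId f n a) :
    (fun z : ℂ => f z / z - 1 - a * z ^ n) =O[𝓝[≠] 0] (fun z : ℂ => z ^ (n + 1)) := by
  obtain ⟨C, hC⟩ := h.isBigO.bound
  refine IsBigO.of_bound C ?_
  filter_upwards [self_mem_nhdsWithin, nhdsWithin_le_nhds hC] with z hz hb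
  have hz' : z ≠ 0 := hz
  have hzp : 0 < ‖z‖ := norm_pos_iff.2 hz'
  have : f z / z - 1 - a * z ^ n = (f z - (z + a * z ^ (n + 1))) / z := by
    field_simp
    ring
  rw [this, norm_div, div_le_iff₀ hzp]
  refine hb.trans (le_of_eq ?_)
  simp only [norm_pow]
  ring

/-- Both `deriv f z` and `(f z / z) ^ (n + 1)` equal `1 + (n + 1) a z ^ n` up to `O(z ^ (n + 1))`,
so the term of order `n` cancels. The remaining order `n + 1` is summable along orbits that decay
like `k ^ (-1/n)`; order `n` would not be. -/
theorem isBigO_multiplier (h : IsTangentToId f n a) (hn : 1 ≤ n) :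
    (fun z : ℂ => deriv f z * (z / f z) ^ (n + 1) - 1) =O[𝓝[≠] 0]
      (fun z : ℂ => z ^ (n + 1)) := by
  set u : ℂ → ℂ := fun z => f z / z with hu
  have hut : Tendsto u (𝓝[≠] 0) (𝓝 1) := h.tendsto_div_self hn
  have hu1 : (fun z => u z - 1 - a * z ^ n) =O[𝓝[≠] 0] (fun z : ℂ => z ^ (n + 1)) :=
    h.isBigO_div_self
  have hpow : ∀ {m l : ℕ}, l ≤ m → (fun z : ℂ => z ^ m) =O[𝓝[≠] 0] (fun z : ℂ => z ^ l) :=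
    fun hml => (isBigO_pow_pow_zero hml).mono nhdsWithin_le_nhds
  have hu2 : (fun z => u z - 1) =O[𝓝[≠] 0] (fun z : ℂ => z ^ n) := by
    refine ((hu1.trans (hpow n.le_succ)).add
      ((isBigO_refl (fun z : ℂ => z ^ n) _).const_mul_left a)).congr_left fun z => ?_
    ring
  have hsum : (fun z => (∑ i ∈ Finset.range (n + 1), u z ^ i) - (n + 1)) =O[𝓝[≠] 0]
      (fun z : ℂ => z ^ n) := by
    have hder : (fun x : ℂ => (∑ i ∈ Finset.range (n + 1), x ^ i) -
        ∑ i ∈ Finset.range (n + 1), (1 : ℂ) ^ i) =O[𝓝 1] (fun x => x - 1) := by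
      have : DifferentiableAt ℂ (fun x : ℂ => ∑ i ∈ Finset.range (n + 1), x ^ i) 1 := by
        fun_prop
      exact this.isBigO_sub
    refine ((hder.comp_tendsto hut).trans hu2).congr_left fun z => ?_
    simp
  have hpu : (fun z => u z ^ (n + 1) - 1 - (n + 1) * a * z ^ n) =O[𝓝[≠] 0]
      (fun z : ℂ => z ^ (n + 1)) := by
    have t1 := (hu2.mul hsum).congr_right fun z => (pow_add z n n).symm
    have t2 := (t1.trans (hpow (show n + 1 ≤ n + n by omega))).add
      (hu1.const_mul_left ((n : ℂ) + 1))
    refine t2.congr_left fun z => ?_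
    rw [← geom_sum_mul]
    ring
  have hd := (h.isBigO_deriv.mono nhdsWithin_le_nhds).sub hpu
  have hinv : (fun z => (u z ^ (n + 1))⁻¹) =O[𝓝[≠] 0] (fun _ : ℂ => (1 : ℂ)) := by
    have : Tendsto (fun z => (u z ^ (n + 1))⁻¹) (𝓝[≠] 0) (𝓝 ((1 ^ (n + 1))⁻¹)) :=
      (hut.pow (n + 1)).inv₀ (by simp)
    exact this.isBigO_one ℂ
  refine (hd.mul hinv).congr' ?_ (by simp)
  filter_upwards [hut.eventually_ne one_ne_zero, self_mem_nhdsWithin] with z h1 hz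
  have hz' : z ≠ 0 := hz
  have hf : f z ≠ 0 := by
    intro h0
    simp [hu, h0] at h1
  simp only [hu, div_pow]
  field_simp
  ring

/-- In the coordinate `-1 / (n a z ^ n)` the germ is asymptotic to the translation by `1`. -/
theorem tendsto_coordinate_sub (h : IsTangentToId f n a) (hn : 1 ≤ n) (ha : a ≠ 0) :
    Tendsto (fun z : ℂ => -1 / (n * a * f z ^ n) - -1 / (n * a * z ^ n)) (𝓝[≠] 0) (𝓝 1) := by
  set u : ℂ → ℂ := fun z => f z / z with hu
  have hut : Tendsto u (𝓝[≠] 0) (𝓝 1) := h.tendsto_div_self hn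
  have hn0 : (n : ℂ) ≠ 0 := by
    exact_mod_cast (by omega : n ≠ 0)
  have h1 : Tendsto (fun z => (u z - 1) / z ^ n) (𝓝[≠] 0) (𝓝 a) := by
    have hlit : (fun z : ℂ => u z - 1 - a * z ^ n) =o[𝓝[≠] 0] (fun z : ℂ => z ^ n) :=
      h.isBigO_div_self.trans_isLittleO
        ((isLittleO_pow_pow (𝕜 := ℂ) (show n < n + 1 by omega)).mono nhdsWithin_le_nhds)
    have := hlit.tendsto_div_nhds_zero.const_add a
    rw [add_zero] at this
    refine this.congr' ?_
    filter_upwards [self_mem_nhdsWithin] with z hz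
    have : z ≠ 0 := hz
    field_simp
    ring
  have h2 : Tendsto (fun z => (∑ i ∈ Finset.range n, u z ^ i) / u z ^ n) (𝓝[≠] 0) (𝓝 n) := by
    have hs : Tendsto (fun z => ∑ i ∈ Finset.range n, u z ^ i) (𝓝[≠] 0)
        (𝓝 (∑ i ∈ Finset.range n, (1 : ℂ) ^ i)) := tendsto_finsetSum _ fun i _ => hut.pow i
    have := hs.div (hut.pow n) (by simp)
    simp only [one_pow, Finset.sum_const, Finset.card_range, nsmul_eq_mul, mul_one, div_one] at this
    exact this
  have h3 := ((h1.mul h2).const_mul (1 / (n * a)))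
  have : 1 / ((n : ℂ) * a) * (a * n) = 1 := by field_simp
  rw [this] at h3
  refine h3.congr' ?_
  filter_upwards [hut.eventually_ne one_ne_zero, self_mem_nhdsWithin] with z h1 hz
  have hz' : z ≠ 0 := hz
  have hf : f z ≠ 0 := by
    intro h0
    simp [hu, h0] at h1
  have hg : (u z - 1) * ∑ i ∈ Finset.range n, u z ^ i = u z ^ n - 1 := by
    rw [mul_comm, geom_sum_mul]
  calc 1 / (n * a) * ((u z - 1) / z ^ n * ((∑ i ∈ Finset.range n, u z ^ i) / u z ^ n))
      = 1 / (n * a) * (((u z - 1) * ∑ i ∈ Finset.range n, u z ^ i) / (z ^ n * u z ^ n)) := by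
        field_simp
    _ = _ := by
        rw [hg]
        simp only [hu, div_pow]
        field_simp
        ring

end IsTangentToId

end Germs

/-! ### Petals and the speed of orbits in them. -/

section Petals

open Filter

/-- The approximate Fatou coordinate `-1 / (n a z ^ n)`. -/
noncomputable def fatouCoord (n : ℕ) (a z : ℂ) : ℂ := -1 / (n * a * z ^ n)

/-- The height function whose superlevel sets are petals. -/
noncomputable def petalHeight (n : ℕ) (a z : ℂ) : ℝ :=
  (fatouCoord n a z).re + |(fatouCoord n a z).im|

/-- The attracting petals of germs `z + a z ^ (n + 1) + ⋯`, all `n` of them together. -/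
def petal (n : ℕ) (a : ℂ) (R : ℝ) : Set ℂ := {z | R < petalHeight n a z}

variable {f : ℂ → ℂ} {n : ℕ} {a z : ℂ} {R : ℝ}

theorem norm_fatouCoord_mul (hn : 1 ≤ n) (ha : a ≠ 0) (hz : z ≠ 0) :
    ‖fatouCoord n a z‖ * (n * ‖a‖ * ‖z‖ ^ n) = 1 := by
  have hn0 : (n : ℝ) ≠ 0 := by exact_mod_cast (by omega : n ≠ 0)
  have h1 : ‖a‖ ≠ 0 := norm_ne_zero_iff.2 ha
  have h2 : ‖z‖ ≠ 0 := norm_ne_zero_iff.2 hz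
  simp only [fatouCoord, norm_div, norm_neg, norm_one, norm_mul, norm_pow, Complex.norm_natCast]
  field_simp

theorem petalHeight_le_two_mul_norm : petalHeight n a z ≤ 2 * ‖fatouCoord n a z‖ := by
  have h1 := Complex.re_le_norm (fatouCoord n a z)
  have h2 := Complex.abs_im_le_norm (fatouCoord n a z)
  simp only [petalHeight]
  linarith

theorem ne_zero_of_mem_petal (hn : 1 ≤ n) (hR : 0 < R) (hz : z ∈ petal n a R) : z ≠ 0 := by
  rintro rfl
  have h0 : n ≠ 0 := by omega
  -- Division by zero makes `fatouCoord n a 0 = 0`, so the height at `0` is `0`.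
  have : R < 0 := by simpa [petal, petalHeight, fatouCoord, h0] using hz
  linarith

theorem isOpen_petal (hn : 1 ≤ n) (ha : a ≠ 0) (hR : 0 < R) : IsOpen (petal n a R) := by
  have hn0 : (n : ℂ) ≠ 0 := by exact_mod_cast (by omega : n ≠ 0)
  have hW : ContinuousOn (fatouCoord n a) {0}ᶜ := by
    refine ContinuousOn.div (by fun_prop) (by fun_prop) fun z hz => ?_
    have : z ≠ 0 := hz
    positivity
  have hQ : ContinuousOn (petalHeight n a) {0}ᶜ :=
    (Complex.continuous_re.comp_continuousOn hW).add
      (continuous_abs.comp_continuousOn (Complex.continuous_im.comp_continuousOn hW))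
  have := hQ.isOpen_inter_preimage isOpen_compl_singleton (isOpen_Ioi (a := R))
  convert this using 1
  ext z
  exact ⟨fun hz => ⟨ne_zero_of_mem_petal hn hR hz, hz⟩, fun hz => hz.2⟩

/-- Turns lower bounds for the height into upper bounds for `‖z‖`. -/
theorem norm_pow_mul_petalHeight_le (hn : 1 ≤ n) (ha : a ≠ 0) (hz : z ≠ 0) :
    n * ‖a‖ * ‖z‖ ^ n * petalHeight n a z ≤ 2 := by
  have h1 := norm_fatouCoord_mul hn ha hz
  have h2 : petalHeight n a z ≤ 2 * ‖fatouCoord n a z‖ := petalHeight_le_two_mul_norm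
  have h3 : 0 ≤ n * ‖a‖ * ‖z‖ ^ n := by positivity
  nlinarith [mul_le_mul_of_nonneg_left h2 h3]

/-- Attracting petals of a germ and of its inverse cover a punctured neighbourhood of `0`. -/
theorem eventually_mem_petal_or (hn : 1 ≤ n) (ha : a ≠ 0) (R R' : ℝ) :
    ∀ᶠ z in 𝓝[≠] (0 : ℂ), z ∈ petal n a R ∨ z ∈ petal n (-a) R' := by
  set M := |R| + |R'| + 1 with hM
  have hM0 : 0 < M := by positivity
  have hlim : Tendsto (fun z : ℂ => 2 * M * (n * ‖a‖ * ‖z‖ ^ n)) (𝓝[≠] 0) (𝓝 0) := by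
    have hc : Continuous fun z : ℂ => 2 * M * (n * ‖a‖ * ‖z‖ ^ n) := by fun_prop
    have h0 : n ≠ 0 := by omega
    have := hc.tendsto 0
    simp only [norm_zero, zero_pow h0, mul_zero] at this
    exact this.mono_left nhdsWithin_le_nhds
  filter_upwards [hlim.eventually (gt_mem_nhds one_pos), self_mem_nhdsWithin] with z hz hz0
  have h1 := norm_fatouCoord_mul hn ha (show z ≠ 0 from hz0)
  have hpos : 0 ≤ n * ‖a‖ * ‖z‖ ^ n := by positivity
  have hW : 2 * M < ‖fatouCoord n a z‖ := by
    by_contra! hcon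
    nlinarith [mul_le_mul_of_nonneg_right hcon hpos]
  have hneg : fatouCoord n (-a) z = -fatouCoord n a z := by
    simp only [fatouCoord, mul_neg, neg_mul, div_neg]
  have h2 := Complex.norm_le_abs_re_add_abs_im (fatouCoord n a z)
  have hR := le_abs_self R
  have hR' := le_abs_self R'
  have := abs_nonneg R
  have := abs_nonneg R'
  have him := abs_nonneg (fatouCoord n a z).im
  -- Changing `a` to `-a` negates the coordinate `W`. For one of the two signs the height is `|Re W|
  -- + |Im W| ≥ ‖W‖`.
  simp only [petal, petalHeight, mem_ofPred_eq, hneg, Complex.neg_re, Complex.neg_im, abs_neg]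
  rcases le_total 0 (fatouCoord n a z).re with h | h
  · rw [abs_of_nonneg h] at h2
    left
    linarith
  · rw [abs_of_nonpos h] at h2
    right
    linarith

/-- An open set which is mapped into itself and in which the orbits tend to `0` at the speed
that is typical for germs `z + a z ^ (n + 1) + ⋯`. -/
structure IsParabolicRegion (f : ℂ → ℂ) (n : ℕ) (P : Set ℂ) : Prop where
  isOpen : IsOpen P
  ne_zero : ∀ z ∈ P, z ≠ 0
  mapsTo : MapsTo f P P
  exists_bound : ∃ e : ℕ → ℝ, Tendsto e atTop (𝓝 0) ∧ Summable (fun k => e k ^ (n + 1)) ∧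
    ∀ z ∈ P, ∀ k, ‖f^[k] z‖ ≤ e k
  exists_comparison : ∀ z₀ ∈ P, ∃ M : ℝ, 0 < M ∧ ∀ z ∈ P, ∀ k, ‖f^[k] z‖ ≤ M * ‖f^[k] z₀‖

/-- With `W = fatouCoord n a`, each step is a translation by `1` with error at most `1 / 4` in both
`Re W` and `Im W`, so the height gains at least `1 / 2` while `‖W‖` gains at most `2`. Linear bounds
for `W` on both sides give the decay `k ^ (-1/n)` and the comparability of orbits. -/
theorem isParabolicRegion_petal (hn : 1 ≤ n) (ha : a ≠ 0) (hR : 0 < R)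
    (hf : ∀ z ∈ petal n a R, ‖fatouCoord n a (f z) - fatouCoord n a z - 1‖ ≤ 1 / 4) :
    IsParabolicRegion f n (petal n a R) := by
  have hstep : ∀ z ∈ petal n a R, petalHeight n a z + 1 / 2 ≤ petalHeight n a (f z) ∧
      ‖fatouCoord n a (f z)‖ ≤ ‖fatouCoord n a z‖ + 2 := by
    intro z hz
    have h := hf z hz
    set d := fatouCoord n a (f z) - fatouCoord n a z - 1 with hd
    have hfz : fatouCoord n a (f z) = fatouCoord n a z + 1 + d := by
      rw [hd]
      ring
    have h1 := (abs_le.1 ((Complex.abs_re_le_norm d).trans h)).1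
    have h2 := (Complex.abs_im_le_norm d).trans h
    constructor
    · simp only [petalHeight, hfz, Complex.add_re, Complex.add_im, Complex.one_re, Complex.one_im,
        add_zero]
      have h3 := abs_sub_abs_le_abs_sub (fatouCoord n a z).im (-d.im)
      rw [abs_neg, sub_neg_eq_add] at h3
      linarith
    · rw [hfz]
      have h3 := norm_add_le (fatouCoord n a z + 1) d
      have h4 := norm_add_le (fatouCoord n a z) 1
      rw [norm_one] at h4
      linarith
  have hmaps : MapsTo f (petal n a R) (petal n a R) := by
    intro z hz
    have h1 := (hstep z hz).1
    have h2 : R < petalHeight n a z := hz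
    change R < petalHeight n a (f z)
    linarith
  have hiter : ∀ z ∈ petal n a R, ∀ k : ℕ, f^[k] z ∈ petal n a R ∧
      R + k / 2 ≤ petalHeight n a (f^[k] z) ∧
      ‖fatouCoord n a (f^[k] z)‖ ≤ ‖fatouCoord n a z‖ + 2 * k := by
    intro z hz k
    induction k with
    | zero =>
      have h2 : R < petalHeight n a z := hz
      refine ⟨hz, ?_, ?_⟩
      · simp [h2.le]
      · simp
    | succ k ih =>
      obtain ⟨h1, h2, h3⟩ := ih
      rw [Function.iterate_succ_apply']
      obtain ⟨h4, h5⟩ := hstep _ h1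
      refine ⟨hmaps h1, ?_, ?_⟩
      · push_cast
        linarith
      · push_cast
        linarith
  have hA : 0 < (n : ℝ) * ‖a‖ := by
    have : 0 < (n : ℝ) := by exact_mod_cast hn
    have := norm_pos_iff.2 ha
    positivity
  have hupper : ∀ z ∈ petal n a R, ∀ k : ℕ,
      n * ‖a‖ * ‖f^[k] z‖ ^ n * (R + k / 2) ≤ 2 := by
    intro z hz k
    obtain ⟨h1, h2, -⟩ := hiter z hz k
    refine le_trans ?_ (norm_pow_mul_petalHeight_le hn ha (ne_zero_of_mem_petal hn hR h1))
    gcongr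
  refine ⟨isOpen_petal hn ha hR, fun z hz => ne_zero_of_mem_petal hn hR hz, hmaps, ?_, ?_⟩
  -- This choice gives `m * (k + 1) ≤ R + k / 2` for all `k`, including `k = 0`.
  · set m := min R (1 / 2) with hm
    have hm0 : 0 < m := lt_min hR (by norm_num)
    set C := 2 / (n * ‖a‖ * m) with hC
    have hC0 : 0 < C := by positivity
    have hn0 : (0 : ℝ) < n := by exact_mod_cast hn
    refine ⟨fun k => (C / (k + 1)) ^ (1 / n : ℝ), ?_, ?_, ?_⟩
    · have h1 : Tendsto (fun k : ℕ => C / ((k : ℝ) + 1)) atTop (𝓝 0) := by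
        have := (tendsto_one_div_add_atTop_nhds_zero_nat (𝕜 := ℝ)).const_mul C
        simpa [div_eq_mul_inv] using this
      have h2 := h1.rpow_const (p := (1 / n : ℝ)) (Or.inr (by positivity))
      rwa [Real.zero_rpow (by positivity)] at h2
    · have h1 : Summable fun k : ℕ => 1 / ((k + 1 : ℕ) : ℝ) ^ ((n + 1) / n : ℝ) := by
        have : (1 : ℝ) < (n + 1) / n := by
          rw [lt_div_iff₀ hn0]
          linarith
        exact (summable_nat_add_iff 1).2 (Real.summable_one_div_nat_rpow.2 this)
      refine (h1.mul_left (C ^ ((n + 1) / n : ℝ))).congr fun k => ?_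
      rw [← Real.rpow_natCast, ← Real.rpow_mul (by positivity), Real.div_rpow hC0.le (by positivity),
        mul_one_div]
      push_cast
      congr 2 <;> ring
    · intro z hz k
      have h1 := hupper z hz k
      have h2 : m * (k + 1) ≤ R + k / 2 := by
        have h3 : m ≤ R := min_le_left _ _
        have h4 : m ≤ 1 / 2 := min_le_right _ _
        have h5 : (0 : ℝ) ≤ k := k.cast_nonneg
        nlinarith
      have h3 : ‖f^[k] z‖ ^ n ≤ C / (k + 1) := by
        rw [hC, div_div, le_div_iff₀ (by positivity)]
        have h4 : 0 ≤ n * ‖a‖ * ‖f^[k] z‖ ^ n := by positivity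
        nlinarith [mul_le_mul_of_nonneg_left h2 h4]
      calc ‖f^[k] z‖ = (‖f^[k] z‖ ^ n) ^ (1 / n : ℝ) := by
            rw [one_div, Real.pow_rpow_inv_natCast (norm_nonneg _) (by omega)]
        _ ≤ (C / (k + 1)) ^ (1 / n : ℝ) := by gcongr
  · intro z₀ hz₀
    -- `M` dominates `2 (‖W z₀‖ + 2 k) / (R + k / 2)` for every `k`, which bounds the ratio of the
    -- `n`-th powers. As `M ≥ 1`, also `M ≤ M ^ n`, so the `n`-th root may be taken.
    set M := 2 * (‖fatouCoord n a z₀‖ / R + 4) with hM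
    have hM1 : 1 ≤ M := by
      have : 0 ≤ ‖fatouCoord n a z₀‖ / R := by positivity
      linarith
    refine ⟨M, by linarith, fun z hz k => ?_⟩
    have h1 := hupper z hz k
    obtain ⟨h2, -, h3⟩ := hiter z₀ hz₀ k
    have h4 := norm_fatouCoord_mul hn ha (ne_zero_of_mem_petal hn hR h2)
    set x := ‖f^[k] z‖ with hx
    set y := ‖f^[k] z₀‖ with hy
    have hk : (0 : ℝ) ≤ k := k.cast_nonneg
    have h5 : 1 ≤ (‖fatouCoord n a z₀‖ + 2 * k) * (n * ‖a‖ * y ^ n) := by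
      rw [← h4]
      gcongr
    have h6 : 2 * (‖fatouCoord n a z₀‖ + 2 * k) ≤ M * (R + k / 2) := by
      have e : M * (R + k / 2) = 2 * ‖fatouCoord n a z₀‖ + ‖fatouCoord n a z₀‖ / R * k
          + 8 * R + 4 * k := by
        rw [hM]
        field_simp
        ring
      have : 0 ≤ ‖fatouCoord n a z₀‖ / R * k := by positivity
      rw [e]
      linarith
    have h7 : x ^ n ≤ M * y ^ n := by
      have hpos : 0 < n * ‖a‖ * (R + k / 2) := by positivity
      refine le_of_mul_le_mul_left ?_ hpos
      have hy0 : 0 ≤ n * ‖a‖ * y ^ n := by positivity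
      nlinarith [mul_le_mul_of_nonneg_right h6 hy0]
    have h8 : x ^ n ≤ (M * y) ^ n := by
      rw [mul_pow]
      refine h7.trans ?_
      gcongr
      exact le_self_pow₀ hM1 (by omega)
    exact le_of_pow_le_pow_left₀ (by omega) (by positivity) h8

theorem IsTangentToId.exists_isParabolicRegion (h : IsTangentToId f n a) (hn : 1 ≤ n)
    (ha : a ≠ 0) {N : Set ℂ} (hN : N ∈ 𝓝[≠] (0 : ℂ)) :
    ∃ R, IsParabolicRegion f n (petal n a R) ∧ petal n a R ⊆ N := by
  have h1 : ∀ᶠ z in 𝓝[≠] (0 : ℂ), ‖fatouCoord n a (f z) - fatouCoord n a z - 1‖ ≤ 1 / 4 := by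
    have := ((h.tendsto_coordinate_sub hn ha).sub_const 1).norm
    rw [sub_self, norm_zero] at this
    exact this.eventually (ge_mem_nhds (by norm_num))
  obtain ⟨δ, hδ, hball⟩ := Metric.mem_nhdsWithin_iff.1 (inter_mem hN h1)
  have hA : 0 < (n : ℝ) * ‖a‖ := by
    have : 0 < (n : ℝ) := by exact_mod_cast hn
    have := norm_pos_iff.2 ha
    positivity
  -- The height at which `norm_pow_mul_petalHeight_le` forces `‖z‖ < δ`.
  set R := 2 / (n * ‖a‖ * δ ^ n) with hR
  have hR0 : 0 < R := by positivity
  have hsub : ∀ z ∈ petal n a R, z ∈ N ∩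
      {z | ‖fatouCoord n a (f z) - fatouCoord n a z - 1‖ ≤ 1 / 4} := by
    intro z hz
    have hz0 := ne_zero_of_mem_petal hn hR0 hz
    refine hball ⟨?_, hz0⟩
    have h2 := norm_pow_mul_petalHeight_le hn ha hz0
    have h3 : R < petalHeight n a z := hz
    have hzp : 0 < ‖z‖ := norm_pos_iff.2 hz0
    have h4 : n * ‖a‖ * ‖z‖ ^ n * R < 2 := lt_of_lt_of_le (by gcongr) h2
    have h5 : ‖z‖ ^ n < δ ^ n := by
      rw [hR, mul_div_assoc', div_lt_iff₀ (by positivity)] at h4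
      have : n * ‖a‖ * ‖z‖ ^ n < n * ‖a‖ * δ ^ n := by linarith
      exact lt_of_mul_lt_mul_left this hA.le
    simpa using lt_of_pow_lt_pow_left₀ n hδ.le h5
  exact ⟨R, isParabolicRegion_petal hn ha hR0 fun z hz => (hsub z hz).2, fun z hz => (hsub z hz).1⟩

end Petals

/-! ### Convergence of the renormalized iterates. -/

section Renormalization

open Filter

theorem TendstoLocallyUniformlyOn.pow_of_continuousOn {F : ℕ → ℂ → ℂ} {g : ℂ → ℂ} {s : Set ℂ}
    (hF : TendstoLocallyUniformlyOn F g atTop s) (hg : ContinuousOn g s) (m : ℕ) :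
    TendstoLocallyUniformlyOn (fun k z => F k z ^ m) (fun z => g z ^ m) atTop s := by
  induction m with
  | zero =>
    intro u hu _ _
    exact ⟨_, self_mem_nhdsWithin, .of_forall fun _ _ _ => by simpa using refl_mem_uniformity hu⟩
  | succ m ih => simpa only [pow_succ] using ih.fun_mul₀ hF (hg.pow m) hg

/-- Holomorphic functions that vanish at `z₀` and whose derivatives converge to a function `φ`
with `φ z₀ ≠ 0` converge near `z₀`, and they are uniformly open there. -/
theorem exists_limit_of_tendstoLocallyUniformlyOn_deriv {U : Set ℂ} (hU : IsOpen U) {z₀ : ℂ}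
    (hz₀ : z₀ ∈ U) {L L' : ℕ → ℂ → ℂ} {φ : ℂ → ℂ} (hL : ∀ k, ∀ z ∈ U, HasDerivAt (L k) (L' k z) z)
    (hL0 : ∀ k, L k z₀ = 0) (hlim : TendstoLocallyUniformlyOn L' φ atTop U) (hφ : φ z₀ ≠ 0) :
    ∃ ρ > 0, Metric.ball z₀ ρ ⊆ U ∧ ∃ Ψ : ℂ → ℂ, ∀ z ∈ Metric.ball z₀ ρ,
      HasDerivAt Ψ (φ z) z ∧ φ z ≠ 0 ∧ Tendsto (fun k => L k z) atTop (𝓝 (Ψ z)) ∧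
      ∀ ε > 0, ∃ δ > 0, ∀ᶠ k in atTop, ∀ y, ‖y - Ψ z‖ < δ →
        ∃ ζ ∈ Metric.ball z₀ ρ, ‖ζ - z‖ < ε ∧ L k ζ = y := by
  have hL'd : ∀ k, DifferentiableOn ℂ (L' k) U := by
    intro k
    have h1 : DifferentiableOn ℂ (L k) U := fun z hz =>
      (hL k z hz).differentiableAt.differentiableWithinAt
    exact (h1.deriv hU).congr fun z hz => (hL k z hz).deriv.symm
  have hφd : DifferentiableOn ℂ φ U := hlim.differentiableOn (.of_forall hL'd) hU
  set A := φ z₀ with hA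
  have hA0 : 0 < ‖A‖ := norm_pos_iff.2 hφ
  have hnear : ∀ᶠ z in 𝓝 z₀, ‖φ z - A‖ < ‖A‖ / 4 := by
    have h1 : ContinuousAt φ z₀ := (hφd.differentiableAt (hU.mem_nhds hz₀)).continuousAt
    simpa [dist_eq_norm] using Metric.continuousAt_iff'.1 h1 (‖A‖ / 4) (by positivity)
  obtain ⟨r, hr, hball⟩ := Metric.eventually_nhds_iff_ball.1 (hnear.and (hU.eventually_mem hz₀))
  set ρ := r / 2 with hρ
  have hρ0 : 0 < ρ := half_pos hr
  set B := Metric.ball z₀ ρ with hB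
  have hclosed : Metric.closedBall z₀ ρ ⊆ Metric.ball z₀ r :=
    Metric.closedBall_subset_ball (by linarith)
  have hBU : Metric.closedBall z₀ ρ ⊆ U := fun z hz => (hball z (hclosed hz)).2
  have hBcl : B ⊆ Metric.closedBall z₀ ρ := Metric.ball_subset_closedBall
  have hBU' : B ⊆ U := hBcl.trans hBU
  have hunif : TendstoUniformlyOn L' φ atTop (Metric.closedBall z₀ ρ) :=
    (tendstoLocallyUniformlyOn_iff_forall_isCompact hU).1 hlim _ hBU (isCompact_closedBall _ _)
  obtain ⟨Ψ, hΨ0, hΨ⟩ := (hφd.mono hBU').isExactOn_ball.with_val_at z₀ 0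
  have hconv : Convex ℝ B := convex_ball _ _
  have hz₀B : z₀ ∈ B := Metric.mem_ball_self hρ0
  have hclose : ∀ η > 0, ∀ᶠ k in atTop, ∀ z ∈ B, ‖L k z - Ψ z‖ ≤ η * ρ := by
    intro η hη
    filter_upwards [Metric.tendstoUniformlyOn_iff.1 hunif η hη] with k hk z hz
    have h1 : ∀ w ∈ B, HasDerivWithinAt (fun w => L k w - Ψ w) (L' k w - φ w) B w := fun w hw =>
      ((hL k w (hBU' hw)).sub (hΨ w hw)).hasDerivWithinAt
    have h2 : ∀ w ∈ B, ‖L' k w - φ w‖ ≤ η := fun w hw => by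
      rw [← dist_eq_norm, dist_comm]
      exact (hk w (hBcl hw)).le
    have h3 := hconv.norm_image_sub_le_of_norm_hasDerivWithin_le h1 h2 hz₀B hz
    rw [hL0, hΨ0, sub_zero, sub_zero] at h3
    refine h3.trans ?_
    gcongr
    simpa [hB, dist_eq_norm] using (Metric.mem_ball.1 hz).le
  have htend : ∀ z ∈ B, Tendsto (fun k => L k z) atTop (𝓝 (Ψ z)) := by
    intro z hz
    rw [Metric.tendsto_nhds]
    intro ε hε
    filter_upwards [hclose (ε / (2 * ρ)) (by positivity)] with k hk
    rw [dist_eq_norm]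
    refine (hk z hz).trans_lt ?_
    field_simp
    linarith
  set c : NNReal := ‖A‖₊ / 2 with hc
  -- The errors `‖L' k - φ‖` and `‖φ - A‖` are each below `‖A‖ / 4`, so `L k` is within `‖A‖ / 2` of
  -- the linear map `A`, uniformly in `k`.
  have happrox : ∀ᶠ k in atTop,
      ApproximatesLinearOn (L k) (A • ContinuousLinearMap.id ℂ ℂ) B c := by
    filter_upwards [Metric.tendstoUniformlyOn_iff.1 hunif (‖A‖ / 4) (by positivity)] with k hk
    intro x hx y hy
    have h1 : ∀ w ∈ B, HasDerivWithinAt (fun w => L k w - A * w) (L' k w - A) B w := fun w hw => by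
      refine (((hL k w (hBU' hw)).sub ((hasDerivAt_id w).const_mul A)).congr_deriv
        ?_).hasDerivWithinAt
      rw [mul_one]
    have h2 : ∀ w ∈ B, ‖L' k w - A‖ ≤ ‖A‖ / 2 := fun w hw => by
      have h3 := hk w (hBcl hw)
      have h4 := (hball w (hclosed (hBcl hw))).1
      have h5 := norm_add_le (L' k w - φ w) (φ w - A)
      rw [dist_comm, dist_eq_norm] at h3
      rw [sub_add_sub_cancel] at h5
      linarith
    have h3 := hconv.norm_image_sub_le_of_norm_hasDerivWithin_le h1 h2 hy hx
    have h4 : L k x - L k y - (A • ContinuousLinearMap.id ℂ ℂ) (x - y) =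
        L k x - A * x - (L k y - A * y) := by
      simp
      ring
    rw [h4]
    simpa [hc] using h3
  refine ⟨ρ, hρ0, hBU', Ψ, fun z hz => ⟨hΨ z hz, ?_, htend z hz, ?_⟩⟩
  · intro h0
    have := (hball z (hclosed (hBcl hz))).1
    rw [h0, zero_sub, norm_neg] at this
    linarith
  · intro ε hε
    obtain ⟨ε', hε', hsub⟩ := Metric.nhds_basis_closedBall.mem_iff.1
      (inter_mem (Metric.isOpen_ball.mem_nhds hz) (Metric.ball_mem_nhds z hε))
    -- `L k` maps the `ε'`-ball about `z` onto at least the ball of radius `(‖A‖ - ‖A‖ / 2) * ε'`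
    -- about `L k z`; half of this radius absorbs `L k z - Ψ z`.
    refine ⟨‖A‖ / 4 * ε', by positivity, ?_⟩
    filter_upwards [happrox, Metric.tendsto_nhds.1 (htend z hz) (‖A‖ / 4 * ε') (by positivity)]
      with k hk1 hk2 y hy
    let S : (A • ContinuousLinearMap.id ℂ ℂ).NonlinearRightInverse :=
      { toFun := fun y => A⁻¹ * y
        nnnorm := ‖A‖₊⁻¹
        bound' := fun y => by simp
        right_inv' := fun y => by simp [mul_inv_cancel_left₀ hφ] }
    have hS := hk1.surjOn_closedBall_of_nonlinearRightInverse S hε'.le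
      (hsub.trans inter_subset_left)
    have hy' : y ∈ Metric.closedBall (L k z) ((((S.nnnorm : NNReal) : ℝ)⁻¹ - c) * ε') := by
      have h1 : (((S.nnnorm : NNReal) : ℝ)⁻¹ - c) = ‖A‖ / 2 := by
        simp [S, hc]
        ring
      rw [h1, Metric.mem_closedBall, dist_eq_norm]
      rw [dist_comm, dist_eq_norm] at hk2
      have h2 := norm_add_le (y - Ψ z) (Ψ z - L k z)
      rw [sub_add_sub_cancel] at h2
      linarith
    obtain ⟨ζ, hζ, rfl⟩ := hS hy'
    refine ⟨ζ, (hsub hζ).1, ?_, rfl⟩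
    simpa [dist_eq_norm] using (hsub hζ).2

namespace IsParabolicRegion

variable {f : ℂ → ℂ} {n : ℕ} {P : Set ℂ}

theorem iterate_mem (hP : IsParabolicRegion f n P) {z : ℂ} (hz : z ∈ P) (k : ℕ) :
    f^[k] z ∈ P := hP.mapsTo.iterate k hz

theorem tendsto_iterate (hP : IsParabolicRegion f n P) {z : ℂ} (hz : z ∈ P) :
    Tendsto (fun k => f^[k] z) atTop (𝓝 0) := by
  obtain ⟨e, he, -, hb⟩ := hP.exists_bound
  exact squeeze_zero_norm (hb z hz) he

/-- The chain rule, with the ratios `(f^[j] z / f^[j+1] z) ^ (n + 1)` inserted and telescoped out,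
so that each factor is the multiplier controlled by `isBigO_multiplier`. -/
theorem hasDerivAt_iterate (hP : IsParabolicRegion f n P) (hf : DifferentiableOn ℂ f P) {z : ℂ}
    (hz : z ∈ P) (k : ℕ) :
    HasDerivAt f^[k] ((∏ j ∈ Finset.range k,
      (deriv f (f^[j] z) * (f^[j] z / f (f^[j] z)) ^ (n + 1))) * (f^[k] z / z) ^ (n + 1)) z := by
  induction k with
  | zero => simpa [div_self (hP.ne_zero z hz)] using hasDerivAt_id z
  | succ k ih =>
    have hk := hP.iterate_mem hz k
    have h1 := (hf.differentiableAt (hP.isOpen.mem_nhds hk)).hasDerivAt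
    have h2 := h1.comp z ih
    rw [← Function.iterate_succ'] at h2
    refine h2.congr_deriv ?_
    rw [Function.iterate_succ_apply', Finset.prod_range_succ]
    have h3 := hP.ne_zero z hz
    have h4 := hP.ne_zero _ hk
    have h5 := hP.ne_zero _ (hP.mapsTo hk)
    simp only [div_pow]
    field_simp

/-- The derivative of `f^[k]` on `K` is `O(‖f^[k] z₀‖ ^ (n + 1))`, since the multiplier products are
bounded and orbits are comparable. By the mean value inequality the ratio differs from `1` by
`O(‖f^[k] z₀‖ ^ n)`. -/
theorem tendstoUniformlyOn_ratio (hP : IsParabolicRegion f n P) (hn : 1 ≤ n)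
    (hf : DifferentiableOn ℂ f P)
    {C : ℝ} (hC : ∀ z ∈ P, ‖deriv f z * (z / f z) ^ (n + 1) - 1‖ ≤ C * ‖z‖ ^ (n + 1))
    {z₀ : ℂ} (hz₀ : z₀ ∈ P) {K : Set ℂ} (hK : Convex ℝ K) (hKc : IsCompact K) (hKP : K ⊆ P)
    (hz₀K : z₀ ∈ K) :
    TendstoUniformlyOn (fun k z => f^[k] z / f^[k] z₀) (fun _ => 1) atTop K := by
  obtain ⟨e, -, hsum, hb⟩ := hP.exists_bound
  obtain ⟨M, hM, hcomp⟩ := hP.exists_comparison z₀ hz₀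
  have hC0 : 0 ≤ C := by
    have h1 := (norm_nonneg _).trans (hC z₀ hz₀)
    have h2 : 0 < ‖z₀‖ ^ (n + 1) := pow_pos (norm_pos_iff.2 (hP.ne_zero _ hz₀)) _
    nlinarith
  obtain ⟨μ, hμ, hlow⟩ : ∃ μ : ℝ, 0 < μ ∧ ∀ z ∈ K, μ ≤ ‖z‖ := by
    obtain ⟨w, hw, hmin⟩ := hKc.exists_isMinOn ⟨z₀, hz₀K⟩ continuous_norm.continuousOn
    exact ⟨‖w‖, norm_pos_iff.2 (hP.ne_zero _ (hKP hw)), fun z hz => hmin hz⟩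
  obtain ⟨D, hD⟩ := hKc.isBounded.exists_norm_le
  have hD0 : 0 ≤ D := (norm_nonneg _).trans (hD z₀ hz₀K)
  set E := Real.exp (∑' k, C * e k ^ (n + 1)) with hE
  have hprod : ∀ z ∈ P, ∀ k, ‖∏ j ∈ Finset.range k,
      (deriv f (f^[j] z) * (f^[j] z / f (f^[j] z)) ^ (n + 1))‖ ≤ E := by
    intro z hz k
    have h1 := Finset.norm_prod_one_add_sub_one_le (Finset.range k)
      (fun j => deriv f (f^[j] z) * (f^[j] z / f (f^[j] z)) ^ (n + 1) - 1)
    simp only [add_sub_cancel] at h1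
    have h2 : ∑ j ∈ Finset.range k,
        ‖deriv f (f^[j] z) * (f^[j] z / f (f^[j] z)) ^ (n + 1) - 1‖ ≤ ∑' k, C * e k ^ (n + 1) := by
      refine le_trans (Finset.sum_le_sum fun j _ => ?_)
        ((hsum.mul_left C).sum_le_tsum (Finset.range k) fun j _ => ?_)
      · refine (hC _ (hP.iterate_mem hz j)).trans ?_
        gcongr
        exact hb z hz j
      · have := (norm_nonneg _).trans (hb z hz j)
        positivity
    have h3 := Real.exp_le_exp.2 h2
    have h4 := norm_add_le ((∏ j ∈ Finset.range k,
      (deriv f (f^[j] z) * (f^[j] z / f (f^[j] z)) ^ (n + 1))) - 1) 1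
    rw [sub_add_cancel, norm_one] at h4
    linarith
  set Q := E * (M / μ) ^ (n + 1) * (2 * D) with hQ
  have hE0 : 0 < E := Real.exp_pos _
  have hQ0 : 0 ≤ Q := by positivity
  have hbound : ∀ k, ∀ z ∈ K, ‖f^[k] z / f^[k] z₀ - 1‖ ≤ Q * ‖f^[k] z₀‖ ^ n := by
    intro k z hz
    have hs := hP.ne_zero _ (hP.iterate_mem hz₀ k)
    have hsp : 0 < ‖f^[k] z₀‖ := norm_pos_iff.2 hs
    have h1 : ‖f^[k] z - f^[k] z₀‖ ≤ E * (M * ‖f^[k] z₀‖ / μ) ^ (n + 1) * ‖z - z₀‖ := by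
      refine hK.norm_image_sub_le_of_norm_hasDerivWithin_le
        (fun w hw => (hP.hasDerivAt_iterate hf (hKP hw) k).hasDerivWithinAt) (fun w hw => ?_) hz₀K hz
      rw [norm_mul, norm_pow, norm_div]
      gcongr
      · exact hprod w (hKP hw) k
      · exact hcomp w (hKP hw) k
      · exact hlow w hw
    have h2 : ‖z - z₀‖ ≤ 2 * D := by
      have := norm_sub_le z z₀
      have := hD z hz
      have := hD z₀ hz₀K
      linarith
    rw [div_sub_one hs, norm_div, div_le_iff₀ hsp]
    calc _ ≤ E * (M * ‖f^[k] z₀‖ / μ) ^ (n + 1) * (2 * D) := h1.trans (by gcongr)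
      _ = Q * ‖f^[k] z₀‖ ^ n * ‖f^[k] z₀‖ := by
        rw [hQ]
        simp only [div_pow, mul_pow]
        ring
  rw [Metric.tendstoUniformlyOn_iff]
  intro ε hε
  have hlim : Tendsto (fun k => Q * ‖f^[k] z₀‖ ^ n) atTop (𝓝 0) := by
    have := ((hP.tendsto_iterate hz₀).norm.pow n).const_mul Q
    simpa [show n ≠ 0 by omega] using this
  filter_upwards [hlim.eventually (gt_mem_nhds hε)] with k hk z hz
  rw [dist_comm, dist_eq_norm]
  exact (hbound k z hz).trans_lt hk

/-- The renormalized iterates converge near every point of a parabolic region. -/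
theorem exists_renormalized_limit (hP : IsParabolicRegion f n P) (hn : 1 ≤ n)
    (hf : DifferentiableOn ℂ f P) (hf' : ∀ z ∈ P, deriv f z ≠ 0)
    {C : ℝ} (hC : ∀ z ∈ P, ‖deriv f z * (z / f z) ^ (n + 1) - 1‖ ≤ C * ‖z‖ ^ (n + 1))
    {z₀ : ℂ} (hz₀ : z₀ ∈ P) :
    ∃ ρ > 0, Metric.ball z₀ ρ ⊆ P ∧ ∃ Ψ φ : ℂ → ℂ, ∀ z ∈ Metric.ball z₀ ρ,
      HasDerivAt Ψ (φ z) z ∧ φ z ≠ 0 ∧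
      Tendsto (fun k => f^[k] z / f^[k] z₀) atTop (𝓝 1) ∧
      Tendsto (fun k => (f^[k] z - f^[k] z₀) / f^[k] z₀ ^ (n + 1)) atTop (𝓝 (Ψ z)) ∧
      ∀ ε > 0, ∃ δ > 0, ∀ᶠ k in atTop, ∀ y, ‖y - Ψ z‖ < δ → ∃ ζ ∈ Metric.ball z₀ ρ,
        ‖ζ - z‖ < ε ∧ (f^[k] ζ - f^[k] z₀) / f^[k] z₀ ^ (n + 1) = y := by
  obtain ⟨e, -, hsum, hb⟩ := hP.exists_bound
  obtain ⟨r, hr, hrP⟩ := Metric.nhds_basis_closedBall.mem_iff.1 (hP.isOpen.mem_nhds hz₀)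
  have hrP' : Metric.ball z₀ r ⊆ P := Metric.ball_subset_closedBall.trans hrP
  have hratio := hP.tendstoUniformlyOn_ratio hn hf hC hz₀ (convex_closedBall z₀ r)
    (isCompact_closedBall z₀ r) hrP (Metric.mem_closedBall_self hr.le)
  have hC0 : 0 ≤ C := by
    have h1 := (norm_nonneg _).trans (hC z₀ hz₀)
    have h2 : 0 < ‖z₀‖ ^ (n + 1) := pow_pos (norm_pos_iff.2 (hP.ne_zero _ hz₀)) _
    nlinarith
  set m : ℂ → ℂ := fun z => deriv f z * (z / f z) ^ (n + 1) - 1 with hm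
  have hmc : ContinuousOn m P := by
    have h1 : ContinuousOn (deriv f) P := (hf.deriv hP.isOpen).continuousOn
    have h2 : ContinuousOn (fun z => z / f z) P := continuousOn_id.div hf.continuousOn
      fun z hz => hP.ne_zero _ (hP.mapsTo hz)
    exact (h1.mul (h2.pow _)).sub continuousOn_const
  have hic : ∀ k, ContinuousOn f^[k] P := fun k => hf.continuousOn.iterate hP.mapsTo k
  have hmb : ∀ k, ∀ z ∈ P, ‖m (f^[k] z)‖ ≤ C * e k ^ (n + 1) := by
    intro k z hz
    refine (hC _ (hP.iterate_mem hz k)).trans ?_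
    gcongr
    exact hb z hz k
  have hprod := (Summable.hasProdLocallyUniformlyOn_nat_one_add (f := fun k z => m (f^[k] z))
    hP.isOpen (hsum.mul_left C) (.of_forall hmb)
    fun k => hmc.comp (hic k) (hP.mapsTo.iterate k)).tendstoLocallyUniformlyOn_finsetRange
  set G : ℂ → ℂ := fun z => ∏' k, (1 + m (f^[k] z)) with hG
  have hGc : ContinuousOn G P := by
    refine hprod.continuousOn (.of_forall fun k => ?_)
    exact continuousOn_finsetProd _ fun j _ =>
      continuousOn_const.add (hmc.comp (hic j) (hP.mapsTo.iterate j))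
  have hG0 : G z₀ ≠ 0 := by
    refine tprod_one_add_ne_zero_of_summable (fun k => ?_) ?_
    · have h1 := hP.iterate_mem hz₀ k
      simp only [hm, add_sub_cancel]
      exact mul_ne_zero (hf' _ h1) (pow_ne_zero _ (div_ne_zero (hP.ne_zero _ h1)
        (hP.ne_zero _ (hP.mapsTo h1))))
    · exact (hsum.mul_left C).of_nonneg_of_le (fun k => norm_nonneg _) fun k => hmb k z₀ hz₀
  set L : ℕ → ℂ → ℂ := fun k z => (f^[k] z - f^[k] z₀) / f^[k] z₀ ^ (n + 1) with hLdef
  set L' : ℕ → ℂ → ℂ := fun k z => (∏ j ∈ Finset.range k, (1 + m (f^[j] z))) *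
    (f^[k] z / f^[k] z₀) ^ (n + 1) / z ^ (n + 1) with hL'def
  have hL : ∀ k, ∀ z ∈ Metric.ball z₀ r, HasDerivAt (L k) (L' k z) z := by
    intro k z hz
    have h1 := ((hP.hasDerivAt_iterate hf (hrP' hz) k).sub_const (f^[k] z₀)).div_const
      (f^[k] z₀ ^ (n + 1))
    refine h1.congr_deriv ?_
    simp only [hL'def, hm, add_sub_cancel, div_pow]
    ring
  -- The partial products tend to `G` and the ratio of orbits tends to `1`.
  have hL' : TendstoLocallyUniformlyOn L' (fun z => G z / z ^ (n + 1)) atTop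
      (Metric.ball z₀ r) := by
    have hbc : Metric.ball z₀ r ⊆ Metric.closedBall z₀ r := Metric.ball_subset_closedBall
    have h1 := (hratio.mono hbc).tendstoLocallyUniformlyOn.pow_of_continuousOn
      continuousOn_const (n + 1)
    have h2 : TendstoLocallyUniformlyOn (fun (_ : ℕ) (z : ℂ) => (z ^ (n + 1))⁻¹)
        (fun z => (z ^ (n + 1))⁻¹) atTop (Metric.ball z₀ r) := fun u hu _ _ =>
      ⟨_, self_mem_nhdsWithin, .of_forall fun _ _ _ => refl_mem_uniformity hu⟩
    have h3 := (hprod.mono hrP').fun_mul₀ h1 (hGc.mono hrP') (by fun_prop)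
    have h4 := h3.fun_mul₀ h2 ((hGc.mono hrP').mul (by fun_prop)) (by
      refine ContinuousOn.inv₀ (by fun_prop) fun z hz => ?_
      exact pow_ne_zero _ (hP.ne_zero _ (hrP' hz)))
    simpa only [hL'def, one_pow, mul_one, div_eq_mul_inv] using h4
  obtain ⟨ρ, hρ, hρr, Ψ, hΨ⟩ := exists_limit_of_tendstoLocallyUniformlyOn_deriv
    Metric.isOpen_ball (Metric.mem_ball_self hr) hL (fun k => by simp [hLdef]) hL'
    (div_ne_zero hG0 (pow_ne_zero _ (hP.ne_zero _ hz₀)))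
  refine ⟨ρ, hρ, hρr.trans hrP', Ψ, fun z => G z / z ^ (n + 1), fun z hz => ?_⟩
  obtain ⟨h1, h2, h3, h4⟩ := hΨ z hz
  exact ⟨h1, h2, hratio.tendsto_at (Metric.ball_subset_closedBall (hρr hz)), h3, h4⟩

end IsParabolicRegion

end Renormalization

/-! ### Iterates of `g` as a flow in the renormalized coordinate. -/

section Flow

open Filter

theorem norm_pow_succ_sub_pow_succ_le {x y : ℂ} {r : ℝ} (hx : ‖x‖ ≤ r) (hy : ‖y‖ ≤ r) (m : ℕ) :
    ‖y ^ (m + 1) - x ^ (m + 1)‖ ≤ (m + 1) * r ^ m * ‖y - x‖ := by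
  rw [← (Commute.all y x).geom_sum₂_mul, norm_mul]
  gcongr
  refine (norm_sum_le_of_le (Finset.range (m + 1)) (f := fun i => y ^ i * x ^ (m + 1 - 1 - i))
    (n := fun _ => r ^ m) fun i hi => ?_).trans (by simp)
  have hi' : i + (m + 1 - 1 - i) = m := by
    have := Finset.mem_range.1 hi
    omega
  rw [norm_mul, norm_pow, norm_pow]
  calc ‖y‖ ^ i * ‖x‖ ^ (m + 1 - 1 - i) ≤ r ^ i * r ^ (m + 1 - 1 - i) := by
        have := (norm_nonneg x).trans hx
        gcongr
    _ = r ^ m := by rw [← pow_add, hi']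

/-- The first `T / ‖x‖ ^ (q - p)` iterates of a point `x` under `z + b z ^ (q + 1) + ⋯` follow the
constant vector field `b x ^ (q + 1)`. -/
theorem IsTangentToId.exists_iterate_bound {g : ℂ → ℂ} {q p : ℕ} {b : ℂ}
    (h : IsTangentToId g q b) (hp : 1 ≤ p) (hpq : p ≤ q) {T : ℝ} (hT : 0 ≤ T) :
    ∃ D : ℝ, ∀ᶠ x in 𝓝 (0 : ℂ), ∀ k : ℕ, k * ‖x‖ ^ (q - p) ≤ T →
      ‖g^[k] x‖ ≤ 2 * ‖x‖ ∧ ‖g^[k] x - x - k * b * x ^ (q + 1)‖ ≤ D * k * ‖x‖ ^ (q + 2) := by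
  obtain ⟨C, hC0, hC⟩ := h.isBigO.exists_nonneg
  obtain ⟨r, hr, hball⟩ := Metric.eventually_nhds_iff_ball.1 hC.bound
  -- The first term is the Taylor error of one step at a point of norm at most `2 * ‖x‖`. The second
  -- is the change of `b y ^ (q + 1)` when `y` moves away from `x` by at most `(‖b‖ + 1) * T * ‖x‖ ^
  -- 2`.
  set D := C * 2 ^ (q + 2) + ‖b‖ * ((q + 1) * 2 ^ q * ((‖b‖ + 1) * T)) with hD
  have hD0 : 0 ≤ D := by positivity
  have small : ∀ {c : ℝ}, 0 ≤ c → ∀ᶠ x in 𝓝 (0 : ℂ), c * ‖x‖ ≤ 1 := by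
    intro c _
    have : Tendsto (fun x : ℂ => c * ‖x‖) (𝓝 0) (𝓝 0) := by
      have := ((continuous_norm (E := ℂ)).const_mul c).tendsto 0
      simpa using this
    exact this.eventually (ge_mem_nhds one_pos)
  refine ⟨D, ?_⟩
  filter_upwards [small zero_le_one, small hD0, small (c := (‖b‖ + 1) * T) (by positivity),
    Metric.ball_mem_nhds (0 : ℂ) (half_pos hr)] with x hx1 hxD hxT hxr
  have hxr' : 2 * ‖x‖ < r := by
    have : ‖x‖ < r / 2 := by simpa using hxr
    linarith
  rw [one_mul] at hx1
  have hx0 : 0 ≤ ‖x‖ := norm_nonneg x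
  have hdist : ∀ k : ℕ, k * ‖x‖ ^ (q - p) ≤ T →
      ‖g^[k] x - x - k * b * x ^ (q + 1)‖ ≤ D * k * ‖x‖ ^ (q + 2) →
      ‖g^[k] x - x‖ ≤ (‖b‖ + 1) * T * ‖x‖ ^ 2 := by
    intro k hk hk'
    have e : ‖x‖ ^ (q + 1) = ‖x‖ ^ (q - p) * ‖x‖ ^ (p + 1) := by
      rw [← pow_add]
      congr 1
      omega
    have h1 : ‖x‖ ^ (p + 1) ≤ ‖x‖ ^ 2 := pow_le_pow_of_le_one hx0 hx1 (by omega)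
    have h2 := norm_add_le (g^[k] x - x - k * b * x ^ (q + 1)) (k * b * x ^ (q + 1))
    rw [sub_add_cancel] at h2
    have h3 : ‖(k : ℂ) * b * x ^ (q + 1)‖ = k * ‖b‖ * ‖x‖ ^ (q + 1) := by simp
    calc ‖g^[k] x - x‖ ≤ D * k * ‖x‖ ^ (q + 2) + k * ‖b‖ * ‖x‖ ^ (q + 1) := by linarith
      _ = (‖b‖ + D * ‖x‖) * (k * ‖x‖ ^ (q + 1)) := by ring
      _ ≤ (‖b‖ + 1) * (k * ‖x‖ ^ (q + 1)) := by gcongr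
      _ = (‖b‖ + 1) * (k * ‖x‖ ^ (q - p)) * ‖x‖ ^ (p + 1) := by
        rw [e]
        ring
      _ ≤ (‖b‖ + 1) * T * ‖x‖ ^ 2 := by gcongr
  have hnorm : ∀ k : ℕ, ‖g^[k] x - x‖ ≤ (‖b‖ + 1) * T * ‖x‖ ^ 2 → ‖g^[k] x‖ ≤ 2 * ‖x‖ := by
    intro k hk
    have h1 := norm_add_le (g^[k] x - x) x
    rw [sub_add_cancel] at h1
    nlinarith [mul_le_mul_of_nonneg_right hxT hx0]
  -- A bootstrap: the displacement bound at time `k` keeps the orbit close to `x`, and this gives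
  -- the bound at time `k + 1`.
  suffices ∀ k : ℕ, k * ‖x‖ ^ (q - p) ≤ T →
      ‖g^[k] x - x - k * b * x ^ (q + 1)‖ ≤ D * k * ‖x‖ ^ (q + 2) from
    fun k hk => ⟨hnorm k (hdist k hk (this k hk)), this k hk⟩
  intro k
  induction k with
  | zero => simp
  | succ k ih =>
    intro hk
    have hk' : k * ‖x‖ ^ (q - p) ≤ T := by
      refine le_trans ?_ hk
      gcongr
      simp
    have h1 := ih hk'
    have h2 := hdist k hk' h1
    have h3 := hnorm k h2
    rw [Function.iterate_succ_apply']
    set y := g^[k] x with hy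
    have h4 : ‖g y - (y + b * y ^ (q + 1))‖ ≤ C * (2 * ‖x‖) ^ (q + 2) := by
      refine (hball y (by simpa using h3.trans_lt hxr')).trans ?_
      rw [norm_pow]
      gcongr
    have h5 : ‖b * (y ^ (q + 1) - x ^ (q + 1))‖ ≤
        ‖b‖ * ((q + 1) * (2 * ‖x‖) ^ q * ((‖b‖ + 1) * T * ‖x‖ ^ 2)) := by
      rw [norm_mul]
      gcongr
      exact (norm_pow_succ_sub_pow_succ_le (by linarith) h3 q).trans (by gcongr)
    have e : g y - x - ((k + 1 : ℕ) : ℂ) * b * x ^ (q + 1) = (y - x - k * b * x ^ (q + 1)) +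
        (g y - (y + b * y ^ (q + 1))) + b * (y ^ (q + 1) - x ^ (q + 1)) := by
      push_cast
      ring
    rw [e]
    refine (norm_add₃_le).trans ((add_le_add_three h1 h4 h5).trans (le_of_eq ?_))
    rw [hD]
    push_cast
    simp only [mul_pow]
    ring

theorem iterate_mem_of_invariant {J : Set ℂ} {g : ℂ → ℂ} {N : Set ℂ} {x : ℂ}
    (hN : ∀ w ∈ N, (g w ∈ J ↔ w ∈ J)) {k : ℕ} (hk : ∀ i < k, g^[i] x ∈ N) :
    g^[k] x ∈ J ↔ x ∈ J := by
  induction k with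
  | zero => simp
  | succ k ih =>
    rw [Function.iterate_succ_apply', hN _ (hk k k.lt_succ_self)]
    exact ih fun i hi => hk i (hi.trans k.lt_succ_self)

theorem tendsto_floor_div_mul {u : ℕ → ℝ} (hu : Tendsto u atTop (𝓝 0)) (hu0 : ∀ j, 0 < u j)
    {t : ℝ} (ht : 0 ≤ t) : Tendsto (fun j => (⌊t / u j⌋₊ : ℝ) * u j) atTop (𝓝 t) := by
  have h1 : Tendsto (fun j => t - u j) atTop (𝓝 t) := by simpa using hu.const_sub t
  refine tendsto_of_tendsto_of_tendsto_of_le_of_le h1 tendsto_const_nhds (fun j => ?_) fun j => ?_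
  · have := (Nat.lt_floor_add_one (t / u j)).le
    rw [div_le_iff₀ (hu0 j)] at this
    simp only
    linarith
  · have := Nat.floor_le (show 0 ≤ t / u j from div_nonneg ht (hu0 j).le)
    rwa [le_div_iff₀ (hu0 j)] at this

/-- A closed set that is invariant under `f` and under `g` is invariant under the forward flow
of the limit of the vector fields that `g` induces through the renormalized iterates of `f`. -/
theorem IsParabolicRegion.mem_of_flow {f g : ℂ → ℂ} {p q : ℕ} {P J : Set ℂ} {b : ℂ}
    (hP : IsParabolicRegion f p P) (hp : 1 ≤ p) (hpq : p < q) (hg : IsTangentToId g q b)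
    (hJf : ∀ z ∈ P, (f z ∈ J ↔ z ∈ J)) (hJg : InvariantNearZero J g)
    {z₀ : ℂ} {ρ : ℝ} (hρ : Metric.ball z₀ ρ ⊆ P) (hz₀ : z₀ ∈ P) {z z' w w' : ℂ}
    (hz : z ∈ Metric.ball z₀ ρ) (hzJ : z ∈ J)
    (hratio : Tendsto (fun k => f^[k] z / f^[k] z₀) atTop (𝓝 1))
    (hw : Tendsto (fun k => (f^[k] z - f^[k] z₀) / f^[k] z₀ ^ (p + 1)) atTop (𝓝 w))
    (hw' : ∀ ε > 0, ∃ δ > 0, ∀ᶠ k in atTop, ∀ y, ‖y - w'‖ < δ → ∃ ζ ∈ Metric.ball z₀ ρ,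
        ‖ζ - z'‖ < ε ∧ (f^[k] ζ - f^[k] z₀) / f^[k] z₀ ^ (p + 1) = y)
    {κ : ℕ → ℕ} (hκ : StrictMono κ) {ν : ℂ}
    (hν : Tendsto (fun j => f^[κ j] z₀ / (‖f^[κ j] z₀‖ : ℂ)) atTop (𝓝 ν))
    {t : ℝ} (ht : 0 ≤ t) (hww' : w' = w + t * (b * ν ^ (q - p))) : z' ∈ closure J := by
  obtain ⟨D, hD⟩ := hg.exists_iterate_bound hp hpq.le (T := t + 1) (by linarith)
  have hκt := hκ.tendsto_atTop
  set s : ℕ → ℂ := fun j => f^[κ j] z₀ with hs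
  set x : ℕ → ℂ := fun j => f^[κ j] z with hx
  have hs0 : ∀ j, s j ≠ 0 := fun j => hP.ne_zero _ (hP.iterate_mem hz₀ _)
  have hst : Tendsto s atTop (𝓝 0) := (hP.tendsto_iterate hz₀).comp hκt
  have hxt : Tendsto x atTop (𝓝 0) := (hP.tendsto_iterate (hρ hz)).comp hκt
  have hxs : Tendsto (fun j => x j / s j) atTop (𝓝 1) := hratio.comp hκt
  -- One step of `g` moves the renormalized coordinate by about `b * s j ^ (q - p)`, so this many
  -- steps move it by about `t * b * ν ^ (q - p)`.
  set k : ℕ → ℕ := fun j => ⌊t / ‖s j‖ ^ (q - p)⌋₊ with hk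
  have hkt : Tendsto (fun j => (k j : ℝ) * ‖s j‖ ^ (q - p)) atTop (𝓝 t) := by
    refine tendsto_floor_div_mul ?_ (fun j => pow_pos (norm_pos_iff.2 (hs0 j)) _) ht
    simpa [show q - p ≠ 0 by omega] using hst.norm.pow (q - p)
  set y : ℕ → ℂ := fun j => g^[k j] (x j) with hy
  have hkx : ∀ᶠ j in atTop, (k j : ℝ) * ‖x j‖ ^ (q - p) ≤ t + 1 := by
    have h1 := hkt.mul (hxs.norm.pow (q - p))
    rw [norm_one, one_pow, mul_one] at h1
    filter_upwards [h1.eventually (ge_mem_nhds (lt_add_one t))] with j hj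
    have hsj := norm_ne_zero_iff.2 (hs0 j)
    rw [norm_div, div_pow] at hj
    refine le_trans (le_of_eq ?_) hj
    field_simp
  have hbound : ∀ᶠ j in atTop, ∀ i ≤ k j, ‖g^[i] (x j)‖ ≤ 2 * ‖x j‖ ∧
      ‖g^[i] (x j) - x j - i * b * x j ^ (q + 1)‖ ≤ D * i * ‖x j‖ ^ (q + 2) := by
    filter_upwards [hkx, hxt.eventually hD] with j h1 h2 i hi
    refine h2 i (le_trans ?_ h1)
    gcongr
  have hyJ : ∀ᶠ j in atTop, y j ∈ J := by
    obtain ⟨δ, hδ, hball⟩ := Metric.eventually_nhds_iff_ball.1 hJg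
    have hx2 : Tendsto (fun j => 2 * ‖x j‖) atTop (𝓝 0) := by simpa using hxt.norm.const_mul 2
    filter_upwards [hbound, hx2.eventually (gt_mem_nhds hδ)] with j h1 h2
    rw [iterate_mem_of_invariant hball fun i hi => ?_]
    · exact (iterate_mem_of_invariant hJf fun i _ => hP.iterate_mem (hρ hz) i).2 hzJ
    · simpa using (h1 i hi.le).1.trans_lt h2
  have hyt : Tendsto (fun j => (y j - s j) / s j ^ (p + 1)) atTop (𝓝 w') := by
    have t1 : Tendsto (fun j => (x j - s j) / s j ^ (p + 1)) atTop (𝓝 w) := hw.comp hκt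
    have t2 : Tendsto (fun j => b * (((k j : ℝ) * ‖s j‖ ^ (q - p) : ℝ) : ℂ) *
        (x j / s j) ^ (q + 1) * (s j / (‖s j‖ : ℂ)) ^ (q - p)) atTop
        (𝓝 (b * (t : ℂ) * 1 ^ (q + 1) * ν ^ (q - p))) :=
      (((Complex.continuous_ofReal.tendsto t).comp hkt).const_mul b).mul (hxs.pow _) |>.mul
        (hν.pow _)
    have t3 : Tendsto (fun j => (y j - x j - k j * b * x j ^ (q + 1)) / s j ^ (p + 1)) atTop
        (𝓝 0) := by
      have h1 : Tendsto (fun j => D * ((k j : ℝ) * ‖s j‖ ^ (q - p)) * ‖x j / s j‖ ^ (q + 2) *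
          ‖s j‖) atTop (𝓝 0) := by
        simpa using ((hkt.const_mul D).mul (hxs.norm.pow (q + 2))).mul hst.norm
      refine squeeze_zero_norm' ?_ h1
      filter_upwards [hbound] with j hj
      have hsj := norm_pos_iff.2 (hs0 j)
      rw [norm_div, norm_pow, div_le_iff₀ (by positivity)]
      refine ((hj (k j) le_rfl).2).trans (le_of_eq ?_)
      have e : ‖s j‖ ^ (q + 2) = ‖s j‖ ^ (q - p) * ‖s j‖ * ‖s j‖ ^ (p + 1) := by
        rw [← pow_succ, ← pow_add]
        congr 1
        omega
      rw [norm_div, div_pow]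
      calc D * (k j) * ‖x j‖ ^ (q + 2)
          = D * (k j) * (‖x j‖ ^ (q + 2) / ‖s j‖ ^ (q + 2)) * ‖s j‖ ^ (q + 2) := by field_simp
        _ = _ := by
          nth_rewrite 2 [e]
          ring
    have t4 := (t1.add t2).add t3
    rw [hww']
    convert t4 using 2 with j
    · have hsj := hs0 j
      have hnj : (‖s j‖ : ℂ) ≠ 0 := by exact_mod_cast norm_ne_zero_iff.2 hsj
      have e : s j ^ (q + 1) = s j ^ (q - p) * s j ^ (p + 1) := by
        rw [← pow_add]
        congr 1
        omega
      have e2 : b * (((k j : ℝ) * ‖s j‖ ^ (q - p) : ℝ) : ℂ) *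
          (x j / s j) ^ (q + 1) * (s j / (‖s j‖ : ℂ)) ^ (q - p) =
          k j * b * x j ^ (q + 1) / s j ^ (p + 1) := by
        rw [div_pow, div_pow, e]
        push_cast
        field_simp
      rw [e2]
      ring
    · ring
  rw [Metric.mem_closure_iff]
  intro ε hε
  -- Uniform openness supplies a point `ζ` near `z'` whose iterate is exactly `y j ∈ J`; invariance
  -- under `f` brings membership back to `ζ`.
  obtain ⟨δ, hδ, hev⟩ := hw' ε hε
  obtain ⟨j, h1, h2, h3⟩ := ((hκt.eventually hev).and
    (hyJ.and (Metric.tendsto_nhds.1 hyt δ hδ))).exists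
  obtain ⟨ζ, hζ, hζ', heq⟩ := h1 _ (by rwa [← dist_eq_norm])
  have hfy : f^[κ j] ζ = y j := by
    have := pow_ne_zero (p + 1) (hs0 j)
    simp only [hs] at this heq
    rw [div_left_inj' this] at heq
    exact sub_left_injective heq
  refine ⟨ζ, ?_, by rwa [dist_comm, dist_eq_norm]⟩
  rw [← iterate_mem_of_invariant hJf fun i (_ : i < κ j) => hP.iterate_mem (hρ hζ) i, hfy]
  exact h2

end Flow

/-! ### From flow invariance to the lamination. -/

section Lamination

open Filter

/-- Take `σ = Im (Ψ / c)`. Two points of `B` lie in the same fibre exactly when their values under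
`Ψ` differ by a real multiple of `c`, so `J ∩ B` is saturated by the fibres and `K` can be its
image. -/
theorem AnalyticallyLaminatedAt.of_hasDerivAt {J B : Set ℂ} {z₀ : ℂ} (hB : IsOpen B)
    (hz₀ : z₀ ∈ B) {Ψ φ : ℂ → ℂ} (hΨ : ∀ z ∈ B, HasDerivAt Ψ (φ z) z) (hφ : ∀ z ∈ B, φ z ≠ 0)
    {c : ℂ} (hc : c ≠ 0)
    (hJ : ∀ z ∈ B, ∀ z' ∈ B, ∀ t : ℝ, z ∈ J → Ψ z' = Ψ z + t * c → z' ∈ J) :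
    AnalyticallyLaminatedAt J z₀ := by
  set σ : ℂ → ℝ := fun z => (Ψ z / c).im with hσ
  have hd : ∀ z ∈ B, HasDerivAt (fun z => Ψ z / c) (φ z / c) z := fun z hz => (hΨ z hz).div_const c
  refine ⟨B, σ '' (J ∩ B), σ, hB, hz₀, ?_, fun z hz => ?_, ?_⟩
  · have h1 : AnalyticOnNhd ℂ (fun z => Ψ z / c) B :=
      DifferentiableOn.analyticOnNhd
        (fun z hz => (hd z hz).differentiableAt.differentiableWithinAt) hB
    exact fun z hz => (Complex.imCLM.analyticAt _).comp (h1 z hz).restrictScalars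
  · have h1 : HasFDerivAt σ (Complex.imCLM.comp
        ((ContinuousLinearMap.toSpanSingleton ℂ (φ z / c)).restrictScalars ℝ)) z :=
      Complex.imCLM.hasFDerivAt.comp z ((hd z hz).hasFDerivAt.restrictScalars ℝ)
    rw [h1.fderiv]
    intro y
    have h2 : φ z / c ≠ 0 := div_ne_zero (hφ z hz) hc
    refine ⟨y * Complex.I / (φ z / c), ?_⟩
    simp [div_mul_cancel₀ _ h2]
  · ext z'
    constructor
    · exact fun h => ⟨h.2, mem_image_of_mem σ h⟩
    · rintro ⟨hz', z, ⟨hzJ, hz⟩, hzz'⟩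
      refine ⟨hJ z hz z' hz' ((Ψ z' - Ψ z) / c).re hzJ ?_, hz'⟩
      have h1 : (((Ψ z' - Ψ z) / c).re : ℂ) = (Ψ z' - Ψ z) / c := by
        refine Complex.ext (by simp) ?_
        simp only [hσ] at hzz'
        rw [sub_div, Complex.sub_im, hzz', sub_self, Complex.ofReal_im]
      rw [h1, div_mul_cancel₀ _ hc]
      ring

theorem IsParabolicRegion.analyticallyLaminatedAt {f g h : ℂ → ℂ} {p q : ℕ} {P J : Set ℂ} {b : ℂ}
    (hP : IsParabolicRegion f p P) (hp : 1 ≤ p) (hpq : p < q)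
    (hf : DifferentiableOn ℂ f P) (hf' : ∀ z ∈ P, deriv f z ≠ 0)
    {C : ℝ} (hC : ∀ z ∈ P, ‖deriv f z * (z / f z) ^ (p + 1) - 1‖ ≤ C * ‖z‖ ^ (p + 1))
    (hg : IsTangentToId g q b) (hh : IsTangentToId h q (-b)) (hb : b ≠ 0)
    (hJf : ∀ z ∈ P, (f z ∈ J ↔ z ∈ J)) (hJg : InvariantNearZero J g) (hJh : InvariantNearZero J h)
    (hJ : ∀ z ∈ P, z ∈ closure J → z ∈ J) {z₀ : ℂ} (hz₀ : z₀ ∈ P) :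
    AnalyticallyLaminatedAt J z₀ := by
  obtain ⟨ρ, hρ, hρP, Ψ, φ, hΨ⟩ := hP.exists_renormalized_limit hp hf hf' hC hz₀
  have hs0 : ∀ j, f^[j] z₀ ≠ 0 := fun j => hP.ne_zero _ (hP.iterate_mem hz₀ _)
  -- Compactness of the circle suffices: a limiting direction along one subsequence determines `c`,
  -- and the same subsequence serves both signs of `t`.
  obtain ⟨ν, hν, κ, hκ, hlim⟩ := (isCompact_sphere (0 : ℂ) 1).tendsto_subseq
    (x := fun j => f^[j] z₀ / (‖f^[j] z₀‖ : ℂ)) fun j => by simp [hs0 j]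
  have hν0 : ν ≠ 0 := by
    rintro rfl
    simp at hν
  refine .of_hasDerivAt Metric.isOpen_ball (Metric.mem_ball_self hρ) (fun z hz => (hΨ z hz).1)
    (fun z hz => (hΨ z hz).2.1) (mul_ne_zero hb (pow_ne_zero (q - p) hν0))
    fun z hz z' hz' t hzJ heq => hJ z' (hρP hz') ?_
  obtain ⟨-, -, h1, h2, -⟩ := hΨ z hz
  obtain ⟨-, -, -, -, h3⟩ := hΨ z' hz'
  rcases le_total 0 t with ht | ht
  · exact hP.mem_of_flow hp hpq hg hJf hJg hρP hz₀ hz hzJ h1 h2 h3 hκ hlim ht heq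
  -- Negative times are positive times for `h`, whose leading coefficient is `-b`.
  · refine hP.mem_of_flow hp hpq hh hJf hJh hρP hz₀ hz hzJ h1 h2 h3 hκ hlim (neg_nonneg.2 ht) ?_
    rw [heq]
    push_cast
    ring

theorem IsTangentToId.exists_petal_laminated {f g : ℂ → ℂ} {p q : ℕ} {a b : ℂ} {J : Set ℂ}
    (hf : IsTangentToId f p a) (hg : IsTangentToId g q b) (hp : 1 ≤ p) (hpq : p < q)
    (ha : a ≠ 0) (hb : b ≠ 0) (hJf : InvariantNearZero J f) (hJg : InvariantNearZero J g)
    (hJ : ∀ᶠ z in 𝓝 (0 : ℂ), z ∈ closure J → z ∈ J) :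
    ∃ R, ∀ z ∈ petal p a R, AnalyticallyLaminatedAt J z := by
  obtain ⟨h, hh, hinv⟩ := hg.exists_inverse (by omega)
  obtain ⟨C, hC⟩ := (hf.isBigO_multiplier hp).bound
  have hN := hC.and (nhdsWithin_le_nhds (((hf.analyticAt.eventually_analyticAt).and
    (hf.eventually_deriv_ne_zero hp)).and (hJf.and hJ)))
  obtain ⟨R, hP, hsub⟩ := hf.exists_isParabolicRegion hp ha hN
  refine ⟨R, fun z hz => hP.analyticallyLaminatedAt (C := C) hp hpq
    (fun w hw => (hsub hw).2.1.1.differentiableAt.differentiableWithinAt)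
    (fun w hw => (hsub hw).2.1.2) (fun w hw => ?_) hg hh hb (fun w hw => (hsub hw).2.2.1) hJg
    (IsTangentToId.invariantNearZero_of_inverse hh.tendsto hJg hinv)
    (fun w hw => (hsub hw).2.2.2) hz⟩
  have := (hsub hw).1
  rwa [norm_pow] at this

theorem CompletelyInvariantNearZero.invariantNearZero {U J : Set ℂ} {f : ℂ → ℂ}
    (h : CompletelyInvariantNearZero U f J) : InvariantNearZero J f := by
  obtain ⟨V, hV, hVU, -, h2⟩ := h
  filter_upwards [hV] with z hz
  have := Set.ext_iff.1 h2 z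
  simp only [mem_inter_iff, hVU hz, hz, true_and, and_true, mem_preimage] at this
  exact this

end Lamination

theorem proposition2 (U : Set ℂ) (hU : IsOpen U) (h0 : (0 : ℂ) ∈ U)
    (f g : ℂ → ℂ) (hf : DifferentiableOn ℂ f U) (hg : DifferentiableOn ℂ g U)
    (p q : ℕ) (hp : 1 ≤ p) (hpq : p < q)
    (α β : ℂ) (hα : α ≠ 0) (hβ : β ≠ 0)
    (hfα : (fun z : ℂ => f z - (z + α * z ^ (p + 1))) =O[𝓝 0] (fun z : ℂ => z ^ (p + 2)))
    (hgβ : (fun z : ℂ => g z - (z + β * z ^ (q + 1))) =O[𝓝 0] (fun z : ℂ => z ^ (q + 2)))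
    (J : Set ℂ) (hJU : J ⊆ U) (hJ : IsClosed ((↑) ⁻¹' J : Set U))
    (hJf : CompletelyInvariantNearZero U f J) (hJg : CompletelyInvariantNearZero U g J) :
    ∃ V : Set ℂ, IsOpen V ∧ (0 : ℂ) ∈ V ∧ V ⊆ U ∧ AnalyticallyLaminatedIn J (V \ {0}) := by
  have hU0 := hU.mem_nhds h0
  have tf : IsTangentToId f p α := ⟨hf.analyticAt hU0, hfα⟩
  have tg : IsTangentToId g q β := ⟨hg.analyticAt hU0, hgβ⟩
  have hcl : ∀ᶠ z in 𝓝 (0 : ℂ), z ∈ closure J → z ∈ J := by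
    filter_upwards [hU0] with z hz hzJ
    have h1 := isClosed_preimage_val.1 hJ
    rw [inter_eq_self_of_subset_right hJU] at h1
    exact h1 ⟨hz, hzJ⟩
  -- The attracting petals of the inverse, with coefficient `-α`, are the repelling petals of `f`.
  obtain ⟨k, tk, hk⟩ := tf.exists_inverse hp
  have hJk := IsTangentToId.invariantNearZero_of_inverse tk.tendsto hJf.invariantNearZero hk
  obtain ⟨R, hR⟩ := tf.exists_petal_laminated tg hp hpq hα hβ hJf.invariantNearZero
    hJg.invariantNearZero hcl
  obtain ⟨R', hR'⟩ := tk.exists_petal_laminated tg hp hpq (neg_ne_zero.2 hα) hβ hJk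
    hJg.invariantNearZero hcl
  have hev := eventually_nhdsWithin_iff.1 (eventually_mem_petal_or hp hα R R')
  obtain ⟨V, hV, hVo, hV0⟩ := mem_nhds_iff.1 (Filter.inter_mem hev hU0)
  refine ⟨V, hVo, hV0, fun z hz => (hV hz).2, fun z hz => ?_⟩
  rcases (hV hz.1).1 hz.2 with h | h
  · exact hR z h
  · exact hR' z h
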